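/- Let $F$ be a real or complex Banach space with a finite-dimensional decomposition $(F_i)_{i\in\mathbb N}$, i.e. each $F_i$ is a finite-dimensional subspace of $F$ and every $x\in F$ can be written uniquely as a norm-convergent series $x=\sum_i f_i$ with $f_i\in F_i$. Let $E\subseteq F$ be a closed subspace with unit sphere $S_E$. "Interval" means a non-empty finite interval of $\mathbb N=\{0,1,2,\dots\}$; for such $I$ let $P_I(\sum_i f_i)=\sum_{i\in I}f_i$; we write $n<I$ for $n<\min I$, $I<n$ for $\max I<n$, and $I<J$ for $\max I<\min J$. We write $\Delta>0$ if $\Delta=(\delta_i)_{i\ge 0}$ is a decreasing sequence of strictly positive reals converging to $0$. For $\mathcal A\subseteq S_E^\infty=S_E^{\mathbb N}$ put $$\mathcal A_\Delta=\{(y_i)\in S_E^\infty : \exists (x_i)\in\mathcal A\ \forall i\ \|x_i-y_i\|<\delta_i\}.$$ For a strictly increasing sequence $(m_i)$ of natural numbers and $(x_i)\in S_E^\infty$, write $R_\Delta(m_i,x_i)$ if there are intervals $I_0<I_1<\cdots$ with $\|P_{I_i}(x_i)-x_i\|<\delta_i$ for all $i$, with $m_0<I_0$, and such that for every $i$ there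 is $j$ with $I_i<m_j<m_{j+1}<I_{i+1}$. In the $\Delta$-game, players I and II alternate: in round $k$ player I plays $n_k\in\mathbb N$ and then player II plays a pair $(x_k,I_k)$, where $x_k\in S_E$ and $I_k$ is an interval, subject to $\|x_k-P_{I_k}(x_k)\|<\delta_k$, $n_k<I_k$ and, for $k\ge 1$, $I_{k-1}<I_k$. II has a strategy to play into $\mathcal B\subseteq S_E^\infty$ if II has a strategy that always obeys these rules and guarantees $(x_k)_k\in\mathcal B$, whatever I plays. A $\Delta$-block tree is a non-empty set $T$ of finite sequences in $S_E$, closed under initial segments, such that for every $(x_0,\dots,x_{n-1})\in T$ the set $\{y\in S_E : (x_0,\dots,x_{n-1},y)\in T\}$ can be written as $\{y_i\}_{i=0}^\infty$, where for each $i$ there is an interval $I_i$ with $\|y_i-P_{I_i}(y_i)\|<\delta_n$, and $\min I_i\to\infty$ as $i\to\infty$. Let $[T]$ be the set of its infinite branches, i.e. of $(x_i)\in S_E^\infty$ all of whose finite initial segments are in $T$. **Theorem.** Let $\mathcal A\subseteq S_E^\infty$ be analytic (for the product of the norm topologies). Then the following are equivalent: (a) for every $\Delta>0$ and every strictly increasing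 sequence $(m_i)$ of natural numbers there is $(x_i)\in\mathcal A_\Delta$ with $R_\Delta(m_i,x_i)$; (b) for every $\Delta>0$, player II has a strategy in the $\Delta$-game to play into $\mathcal A_\Delta$; (c) for every $\Delta>0$ there is a $\Delta$-block tree $T$ with $[T]\subseteq\mathcal A_\Delta$. -/

import Mathlib

open Filter Topology

noncomputable section

namespace AsymptoticGame

variable {𝕜 F : Type*} [RCLike 𝕜] [NormedAddCommGroup F] [NormedSpace 𝕜 F]

/-- `V` is a finite-dimensional decomposition (F.D.D.) of `F`: the `V i` are finite-dimensional
subspaces and every `x` is uniquely a norm-convergent series `∑ f i` with `f i ∈ V i`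
(convergence of the ordered partial sums). -/
def IsFDD (V : ℕ → Submodule 𝕜 F) : Prop :=
  (∀ i, FiniteDimensional 𝕜 (V i)) ∧
    ∀ x : F, ∃! f : ℕ → F, (∀ i, f i ∈ V i) ∧
      Tendsto (fun n => ∑ i ∈ Finset.range n, f i) atTop (𝓝 x)

/-- The component of `x` in the `i`-th summand of the decomposition. -/
def IsFDD.coord {V : ℕ → Submodule 𝕜 F} (hV : IsFDD V) (x : F) (i : ℕ) : F :=
  (hV.2 x).exists.choose i

/-- The projection `P_I` of `F` onto the sum of the `V i`, `i ∈ I`, for a non-empty finite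
interval `I = {I.fst, …, I.snd}` of natural numbers. -/
def IsFDD.proj {V : ℕ → Submodule 𝕜 F} (hV : IsFDD V) (I : NonemptyInterval ℕ) (x : F) : F :=
  ∑ i ∈ Finset.Icc I.fst I.snd, hV.coord x i

/-- `Δ > 0`: the sequence `δ` consists of positive reals and decreases to `0`. -/
def DeltaPos (δ : ℕ → ℝ) : Prop :=
  (∀ i, 0 < δ i) ∧ Antitone δ ∧ Tendsto δ atTop (𝓝 0)

/-- The unit sphere of the subspace `E`. -/
abbrev UnitSphere (E : Submodule 𝕜 F) : Type _ := Metric.sphere (0 : E) 1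

variable {E : Submodule 𝕜 F} {V : ℕ → Submodule 𝕜 F}

/-- The infinite sequence `x` is a `Δ`-block, as witnessed by the intervals `I 0 < I 1 < ⋯`. -/
def IsBlockWith (hV : IsFDD V) (δ : ℕ → ℝ) (x : ℕ → UnitSphere E)
    (I : ℕ → NonemptyInterval ℕ) : Prop :=
  (∀ i, (I i).snd < (I (i + 1)).fst) ∧
    ∀ i, ‖hV.proj (I i) ((x i : E) : F) - ((x i : E) : F)‖ < δ i

/-- The relation `R(m, I)`: `m 0 < I 0` and for every `i` there is `j` with
`I i < m j < m (j + 1) < I (i + 1)`. -/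
def Rel (m : ℕ → ℕ) (I : ℕ → NonemptyInterval ℕ) : Prop :=
  m 0 < (I 0).fst ∧
    ∀ i, ∃ j, (I i).snd < m j ∧ m j < m (j + 1) ∧ m (j + 1) < (I (i + 1)).fst

/-- The relation `R_Δ(m, x)`: `x` is a `Δ`-block with a witness `I` satisfying `R(m, I)`. -/
def RelDelta (hV : IsFDD V) (δ : ℕ → ℝ) (m : ℕ → ℕ) (x : ℕ → UnitSphere E) : Prop :=
  ∃ I : ℕ → NonemptyInterval ℕ, IsBlockWith hV δ x I ∧ Rel m I

/-- The `Δ`-expansion `A_Δ` of a set `A` of sequences in the unit sphere. -/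
def expansion (A : Set (ℕ → UnitSphere E)) (δ : ℕ → ℝ) : Set (ℕ → UnitSphere E) :=
  {y | ∃ x ∈ A, ∀ i, ‖(x i : E) - (y i : E)‖ < δ i}

/-- A strategy for player II in the `Δ`-game, assigning to the moves `[n 0, …, n k]` made so far
by player I a pair `(x k, I k)`. (Its value at `[]` is never used.) -/
abbrev StrategyII (E : Submodule 𝕜 F) : Type _ := List ℕ → UnitSphere E × NonemptyInterval ℕ

/-- The answer of II, following `σ`, in round `k`, when I plays `n 0, n 1, …`. -/
def StrategyII.answer (σ : StrategyII E) (n : ℕ → ℕ) (k : ℕ) :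
    UnitSphere E × NonemptyInterval ℕ :=
  σ ((List.range (k + 1)).map n)

/-- `σ` is a strategy for II in the `Δ`-game to play into `B`: against every play
`n 0, n 1, …` of I, all answers `(x k, I k)` obey the rules `‖x k - P_{I k} (x k)‖ < δ k` and
`n k < I k < I (k + 1)`, and the sequence `x` belongs to `B`. -/
def StrategyII.PlaysInto (hV : IsFDD V) (δ : ℕ → ℝ) (σ : StrategyII E)
    (B : Set (ℕ → UnitSphere E)) : Prop :=
  ∀ n : ℕ → ℕ,
    (∀ k, ‖((σ.answer n k).1 : F) - hV.proj (σ.answer n k).2 ((σ.answer n k).1 : F)‖ < δ k) ∧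
    (∀ k, n k < (σ.answer n k).2.fst) ∧
    (∀ k, (σ.answer n k).2.snd < (σ.answer n (k + 1)).2.fst) ∧
    (fun k => (σ.answer n k).1) ∈ B

/-- `T` is a `Δ`-block tree of finite sequences in the unit sphere of `E`. -/
def IsBlockTree (hV : IsFDD V) (δ : ℕ → ℝ) (T : Set (List (UnitSphere E))) : Prop :=
  T.Nonempty ∧
  (∀ s ∈ T, ∀ t : List (UnitSphere E), t <+: s → t ∈ T) ∧
  ∀ s ∈ T, ∃ (y : ℕ → UnitSphere E) (I : ℕ → NonemptyInterval ℕ),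
    {z : UnitSphere E | s ++ [z] ∈ T} = Set.range y ∧
    (∀ i, ‖((y i : E) : F) - hV.proj (I i) ((y i : E) : F)‖ < δ s.length) ∧
    Tendsto (fun i => (I i).fst) atTop atTop

/-- The set `[T]` of infinite branches of `T`. -/
def branches (T : Set (List (UnitSphere E))) : Set (ℕ → UnitSphere E) :=
  {x | ∀ n, (List.range n).map x ∈ T}

end AsymptoticGame

end

/-! (b) ⇒ (c) ⇒ (a) is direct: the answers of a strategy form a tree
(`StrategyII.PlaysInto.exists_tree`), and climbing a block tree through children supported far
enough out gives a branch spread out relative to any given `m` (`IsBlockTree.exists_branch`).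

For (a) ⇒ (b), write the non-empty analytic set as `range f` with `f` continuous on the Baire space.
In an unfolded game II also reveals, with any delay, the terms of a parameter `w` for which `f w` is
close to the points played, and must reveal infinitely many. This Büchi game is positionally
determined (`buchi_determined`). If II wins it, continuity of `f` yields the strategy
(`exists_strategy_of_unfolded`). Suppose instead that I wins by a positional strategy. Positions
record only the moves of II; with points taken from finite nets (`exists_finite_net`) and `w`
revealed slowly, finitely many positions lie below any bound, so some `m` outgrows the replies of I.
The sequence that (a) provides for this `m`, moved into the nets, defeats I
(`not_unfolded_strategy`). -/

namespace AsymptoticGame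

/-! ### Ordinal ranks on least fixed points -/

section Rank

universe u

variable {X : Type u}

/-- The transfinite approximations from below of the least fixed point of `Γ`. -/
def stage (Γ : Set X →o Set X) (a : Ordinal.{u}) : Set X :=
  Γ {q | ∃ b, ∃ _ : b < a, q ∈ stage Γ b}
termination_by a

theorem mem_stage {Γ : Set X →o Set X} {a : Ordinal.{u}} {p : X} :
    p ∈ stage Γ a ↔ p ∈ Γ {q | ∃ b < a, q ∈ stage Γ b} := by
  rw [stage]
  simp only [exists_prop]

theorem stage_subset_lfp (Γ : Set X →o Set X) (a : Ordinal.{u}) : stage Γ a ⊆ Γ.lfp := by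
  induction a using WellFoundedLT.induction with
  | ind a ih =>
    intro p hp
    rw [mem_stage] at hp
    rw [← Γ.map_lfp]
    refine Γ.monotone ?_ hp
    rintro q ⟨b, hb, hq⟩
    exact ih b hb hq

/-- The union of the stages is closed under `Γ`: since `X` lives in the universe of the ordinals
used, one supremum exceeds chosen stages of all its members. -/
theorem exists_mem_stage {Γ : Set X →o Set X} {p : X} (hp : p ∈ Γ.lfp) :
    ∃ a, p ∈ stage Γ a := by
  have key : Γ.lfp ≤ {p | ∃ a, p ∈ stage Γ a} := by
    refine Γ.lfp_le ?_
    intro p hp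
    choose! g hg using fun (q : X) (hq : q ∈ {p | ∃ a, p ∈ stage Γ a}) => hq
    refine ⟨⨆ q : X, Order.succ (g q), ?_⟩
    rw [mem_stage]
    refine Γ.monotone ?_ hp
    intro q hq
    refine ⟨g q, ?_, hg q hq⟩
    exact lt_of_lt_of_le (Order.lt_succ _) (Ordinal.le_iSup (fun q : X => Order.succ (g q)) q)
  exact key hp

/-- The least fixed point of a monotone operator carries an ordinal rank. -/
theorem exists_rank (Γ : Set X →o Set X) : ∃ ρ : X → Ordinal.{u},
    (∀ p ∈ Γ.lfp, p ∈ Γ {q | q ∈ Γ.lfp ∧ ρ q < ρ p}) ∧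
      ∀ p a, p ∈ Γ {q | q ∈ Γ.lfp ∧ ρ q < a} → ρ p ≤ a := by
  refine ⟨fun p => sInf {a | p ∈ stage Γ a}, ?_, ?_⟩
  · intro p hp
    have h : p ∈ stage Γ (sInf {a | p ∈ stage Γ a}) := csInf_mem (exists_mem_stage hp)
    rw [mem_stage] at h
    refine Γ.monotone ?_ h
    rintro q ⟨b, hb, hq⟩
    exact ⟨stage_subset_lfp Γ b hq, lt_of_le_of_lt (csInf_le' hq) hb⟩
  · intro p a hp
    refine csInf_le' ?_
    change p ∈ stage Γ a
    rw [mem_stage]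
    refine Γ.monotone ?_ hp
    rintro q ⟨hq, hqa⟩
    exact ⟨_, hqa, csInf_mem (exists_mem_stage hq)⟩

end Rank

/-! ### Positional determinacy of Büchi games -/

section Buchi

universe u v

variable {X : Type u} {M : Type v} (next : X → M → X) (legal : X → ℕ → M → Prop)
  (good : M → Prop)

/-- One round of the attempt of player II to make a good move into `W`. -/
def reachStep (W : Set X) : Set X →o Set X where
  toFun Y := {p | ∀ n, ∃ a, legal p n a ∧ (next p a ∈ W ∧ good a ∨ next p a ∈ Y)}
  monotone' := by
    intro Y Z hYZ p hp n
    obtain ⟨a, ha, h⟩ := hp n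
    exact ⟨a, ha, h.imp_right fun h => hYZ h⟩

/-- The positions from which player I can keep II from making a good move outside `L`. -/
def safe : Set X →o Set X where
  toFun L := (reachStep next legal good Lᶜ).lfpᶜ
  monotone' := by
    intro L L' h
    refine Set.compl_subset_compl.2 ((reachStep next legal good L'ᶜ).lfp_le ?_)
    intro p hp
    rw [← OrderHom.map_lfp]
    intro n
    obtain ⟨a, ha, h'⟩ := hp n
    exact ⟨a, ha, h'.imp_left fun h' => ⟨fun hL => h'.1 (h hL), h'.2⟩⟩

variable {next legal good}

theorem exists_of_mem_safe {L : Set X} {p : X} (hp : p ∈ safe next legal good L) :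
    ∃ n, ∀ a, legal p n a →
      next p a ∈ safe next legal good L ∧ (good a → next p a ∈ L) := by
  have h : p ∉ (reachStep next legal good Lᶜ).lfp := hp
  rw [← OrderHom.map_lfp] at h
  by_contra! hcon
  refine h fun n => ?_
  obtain ⟨a, ha, h'⟩ := hcon n
  refine ⟨a, ha, ?_⟩
  by_cases hs : next p a ∈ safe next legal good L
  · exact Or.inl ⟨(h' hs).2, (h' hs).1⟩
  · exact Or.inr (not_not.1 hs)

/-- Positional determinacy of the games in which player I plays natural numbers and player II
wins if all moves of II are legal and infinitely many of them are good. -/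
theorem buchi_determined [Nonempty M] (p₀ : X) :
    (∃ ans : X → ℕ → M, ∀ (n : ℕ → ℕ) (p : ℕ → X), p 0 = p₀ →
      (∀ k, p (k + 1) = next (p k) (ans (p k) (n k))) →
      (∀ k, legal (p k) (n k) (ans (p k) (n k))) ∧
        ∃ᶠ k in atTop, good (ans (p k) (n k))) ∨
    (∃ φ : X → ℕ, ∀ (p : ℕ → X) (a : ℕ → M), p 0 = p₀ →
      (∀ k, p (k + 1) = next (p k) (a k)) → (∀ k, legal (p k) (φ (p k)) (a k)) →
      ¬ ∃ᶠ k in atTop, good (a k)) := by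
  set L := (safe next legal good).lfp with hL
  have hfix : safe next legal good L = L := OrderHom.map_lfp _
  by_cases hp₀ : p₀ ∈ L
  · right
    -- Under `φ` the rank never increases (by `h2`) and drops at each good move, so only finitely
    -- many moves are good.
    obtain ⟨ρ, h1, h2⟩ := exists_rank (safe next legal good)
    rw [← hL] at h1 h2
    choose! φ hφ using fun p hp => exists_of_mem_safe (h1 p hp)
    refine ⟨φ, fun p a h0 hs hleg hinf => ?_⟩
    have hmem : ∀ k, p k ∈ L := by
      intro k
      induction k with
      | zero => rwa [h0]
      | succ k ih =>
        rw [hs, ← hfix]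
        exact (safe next legal good).monotone (fun q hq => hq.1) (hφ _ ih _ (hleg k)).1
    have hanti : Antitone fun k => ρ (p k) := by
      refine antitone_nat_of_succ_le fun k => ?_
      rw [hs]
      exact h2 _ _ (hφ _ (hmem k) _ (hleg k)).1
    have hlt : ∀ k, good (a k) → ρ (p (k + 1)) < ρ (p k) := by
      intro k hk
      rw [hs]
      exact ((hφ _ (hmem k) _ (hleg k)).2 hk).2
    obtain ⟨_, ⟨k, rfl⟩, hk⟩ := wellFounded_lt.has_min (Set.range fun k => ρ (p k)) ⟨_, 0, rfl⟩
    obtain ⟨l, hkl, hl⟩ := frequently_atTop.1 hinf k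
    exact hk _ ⟨l + 1, rfl⟩ ((hlt l hl).trans_le (hanti hkl))
  · left
    have hW : (reachStep next legal good Lᶜ).lfp = Lᶜ := by
      conv_rhs => rw [← hfix]
      exact (compl_compl _).symm
    -- Here the rank drops with every move until a good one is made, and the play stays outside `L`,
    -- so II can start again.
    obtain ⟨ρ, h1, -⟩ := exists_rank (reachStep next legal good Lᶜ)
    rw [hW] at h1
    have h1' : ∀ p n, p ∈ Lᶜ → ∃ a, legal p n a ∧ (next p a ∈ Lᶜ ∧ good a ∨
        next p a ∈ Lᶜ ∧ ρ (next p a) < ρ p) := fun p n hp => h1 p hp n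
    choose! ans hans using h1'
    refine ⟨ans, fun n p h0 hs => ?_⟩
    have hmem : ∀ k, p k ∈ Lᶜ := by
      intro k
      induction k with
      | zero => rwa [h0]
      | succ k ih =>
        rw [hs]
        exact (hans _ (n k) ih).2.elim (fun h => h.1) fun h => h.1
    refine ⟨fun k => (hans _ _ (hmem k)).1, ?_⟩
    rw [frequently_atTop]
    by_contra! hcon
    obtain ⟨K, hK⟩ := hcon
    have hlt : ∀ k ≥ K, ρ (p (k + 1)) < ρ (p k) := by
      intro k hk
      rw [hs]
      exact ((hans _ (n k) (hmem k)).2.resolve_left fun h => hK k hk h.2).2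
    obtain ⟨_, ⟨k, rfl⟩, hk⟩ :=
      wellFounded_lt.has_min (Set.range fun k => ρ (p (K + k))) ⟨_, 0, rfl⟩
    exact hk _ ⟨k + 1, rfl⟩ (hlt (K + k) (Nat.le_add_right _ _))

end Buchi

variable {𝕜 F : Type*} [RCLike 𝕜] [NormedAddCommGroup F] [NormedSpace 𝕜 F]
  {E : Submodule 𝕜 F} {V : ℕ → Submodule 𝕜 F}

/-! ### From strategies to block trees to branches -/

section Trees

theorem map_range_succ {α : Type*} (x : ℕ → α) (k : ℕ) :
    (List.range (k + 1)).map x = (List.range k).map x ++ [x k] := by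
  simp [List.range_succ]

/-- A block tree has a branch that is a block sequence in the relation `R_Δ` to a given `m`. -/
theorem IsBlockTree.exists_branch {hV : IsFDD V} {δ : ℕ → ℝ} {T : Set (List (UnitSphere E))}
    (hT : IsBlockTree hV δ T) {m : ℕ → ℕ} (hm : StrictMono m) :
    ∃ x ∈ branches T, RelDelta hV δ m x := by
  obtain ⟨⟨s₀, hs₀⟩, hpre, hch⟩ := hT
  have hnil : ([] : List (UnitSphere E)) ∈ T := hpre _ hs₀ _ List.nil_prefix
  have hstep : ∀ (s : List (UnitSphere E)) (N : ℕ), s ∈ T →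
      ∃ z : UnitSphere E × NonemptyInterval ℕ, s ++ [z.1] ∈ T ∧
        ‖hV.proj z.2 ((z.1 : E) : F) - ((z.1 : E) : F)‖ < δ s.length ∧ N < z.2.fst := by
    intro s N hs
    obtain ⟨y, I, hy, hI, hlim⟩ := hch s hs
    obtain ⟨i, hi⟩ := (hlim.eventually_gt_atTop N).exists
    have hmem : y i ∈ {z : UnitSphere E | s ++ [z] ∈ T} := hy ▸ ⟨i, rfl⟩
    exact ⟨(y i, I i), hmem, by rw [norm_sub_rev]; exact hI i, hi⟩
  have : Nonempty (UnitSphere E × NonemptyInterval ℕ) := ⟨(hstep _ 0 hnil).choose⟩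
  choose! g hg using hstep
  -- If the current interval ends at `e`, the next one must start beyond `m (e + 2)`. As `i ≤ m i`,
  -- the terms `m (e + 1)` and `m (e + 2)` then separate the two.
  let next : List (UnitSphere E) × ℕ → List (UnitSphere E) × ℕ := fun p =>
    (p.1 ++ [(g p.1 p.2).1], m ((g p.1 p.2).2.snd + 2))
  let p : ℕ → List (UnitSphere E) × ℕ := fun k => next^[k] ([], m 0)
  have hp : ∀ k, p (k + 1) = next (p k) := fun k => Function.iterate_succ_apply' _ _ _
  let z : ℕ → UnitSphere E × NonemptyInterval ℕ := fun k => g (p k).1 (p k).2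
  have hps : ∀ k, (p k).1 = (List.range k).map fun i => (z i).1 := by
    intro k
    induction k with
    | zero => rfl
    | succ k ih => rw [hp, map_range_succ, ← ih]
  have hmem : ∀ k, (p k).1 ∈ T := by
    intro k
    induction k with
    | zero => exact hnil
    | succ k ih => rw [hp]; exact (hg _ (p k).2 ih).1
  have hfst : ∀ k, m ((z k).2.snd + 2) < (z (k + 1)).2.fst := by
    intro k
    have h := (hg _ (p (k + 1)).2 (hmem (k + 1))).2.2
    have h' : (p (k + 1)).2 = m ((z k).2.snd + 2) := by rw [hp]
    exact h' ▸ h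
  refine ⟨fun k => (z k).1, fun k => by rw [← hps]; exact hmem k, fun k => (z k).2,
    ⟨fun k => ?_, fun k => ?_⟩, ?_, fun k => ⟨(z k).2.snd + 1, ?_, hm (Nat.lt_succ_self _), hfst k⟩⟩
  · have := hm.id_le ((z k).2.snd + 2)
    have := hfst k
    simp only [id] at *
    omega
  · have h := (hg _ (p k).2 (hmem k)).2.1
    rwa [show (p k).1.length = k by rw [hps]; simp] at h
  · exact (hg _ _ hnil).2.2
  · exact lt_of_lt_of_le (Nat.lt_succ_self _) (hm.id_le _)

open Classical in
/-- A history of moves of player I that leads `σ` to a given finite sequence of answers. -/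
noncomputable def StrategyII.history (σ : StrategyII E) (s : List (UnitSphere E)) : List ℕ :=
  s.foldl (fun l y => l ++ [if h : ∃ n, (σ (l ++ [n])).1 = y then h.choose else 0]) []

open Classical in
theorem StrategyII.history_concat (σ : StrategyII E) (s : List (UnitSphere E))
    (y : UnitSphere E) : σ.history (s ++ [y]) = σ.history s ++
      [if h : ∃ n, (σ (σ.history s ++ [n])).1 = y then h.choose else 0] := by
  rw [history, List.foldl_append]
  rfl

/-- A strategy to play into `B` yields a block tree all of whose branches are in `B`. -/
theorem StrategyII.PlaysInto.exists_tree {hV : IsFDD V} {δ : ℕ → ℝ} {σ : StrategyII E}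
    {B : Set (ℕ → UnitSphere E)} (hσ : σ.PlaysInto hV δ B) :
    ∃ T : Set (List (UnitSphere E)), IsBlockTree hV δ T ∧ branches T ⊆ B := by
  classical
  have hlen : ∀ s, (σ.history s).length = s.length := by
    intro s
    induction s using List.reverseRecOn with
    | nil => rfl
    | append_singleton s y ih => simp [history_concat, ih]
  have hext : ∀ (l : List ℕ) (n : ℕ), ∃ ν : ℕ → ℕ, (List.range l.length).map ν = l ∧
      ν l.length = n := by
    intro l n
    refine ⟨fun i => (l ++ [n]).getD i 0, ?_, ?_⟩
    · refine List.ext_getElem (by simp) fun i h1 h2 => ?_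
      simp [List.getElem?_append_left h2, h2]
    · simp
  -- Fixing one history per node makes each branch the outcome of a single play of I. On nodes of
  -- this tree the default `0` in `history` never occurs.
  refine ⟨{s | ∀ t y, t ++ [y] <+: s → ∃ n, (σ (σ.history t ++ [n])).1 = y},
    ⟨⟨[], ?_⟩, fun s hs t hts t' y h => hs t' y (h.trans hts), fun s hs => ?_⟩, ?_⟩
  · intro t y h
    simp at h
  · refine ⟨fun n => (σ (σ.history s ++ [n])).1, fun n => (σ (σ.history s ++ [n])).2, ?_, ?_, ?_⟩
    · ext z
      constructor
      · intro hz
        exact hz s z (List.prefix_refl _)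
      · rintro ⟨n, rfl⟩ t y h
        rcases List.prefix_concat_iff.1 h with h | h
        · obtain ⟨rfl, h⟩ := List.append_inj' h rfl
          exact ⟨n, by simpa using h.symm⟩
        · exact hs t y h
    · intro n
      obtain ⟨ν, h1, h2⟩ := hext (σ.history s) n
      have h := (hσ ν).1 (σ.history s).length
      rwa [answer, map_range_succ, h1, h2, hlen] at h
    · refine tendsto_atTop_mono (fun n => ?_) tendsto_id
      obtain ⟨ν, h1, h2⟩ := hext (σ.history s) n
      have h := (hσ ν).2.1 (σ.history s).length
      rw [answer, map_range_succ, h1, h2] at h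
      exact h.le
  · intro x hx
    have hex : ∀ k, ∃ n, (σ (σ.history ((List.range k).map x) ++ [n])).1 = x k := fun k =>
      hx (k + 1) _ _ (by rw [map_range_succ])
    let ν : ℕ → ℕ := fun k => (hex k).choose
    have hν : ∀ k, σ.history ((List.range k).map x) = (List.range k).map ν := by
      intro k
      induction k with
      | zero => rfl
      | succ k ih =>
        rw [map_range_succ, map_range_succ, ← ih, history_concat, dif_pos (hex k)]
    have h := (hσ ν).2.2.2
    convert h using 1
    funext k
    rw [answer, map_range_succ, ← hν]
    exact (hex k).choose_spec.symm

end Trees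

/-! ### The unfolded game -/

section Unfolding

/-- The points of the sphere that are close to their projection onto an interval are, up to a
given precision, in a finite set of such points. -/
theorem exists_finite_net (hV : IsFDD V) (J : NonemptyInterval ℕ) {η : ℝ} (hη : 0 < η) :
    ∃ D : Set (UnitSphere E), D.Finite ∧
      (∀ y ∈ D, ‖hV.proj J ((y : E) : F) - ((y : E) : F)‖ < η) ∧
      ∀ x : UnitSphere E, ‖hV.proj J ((x : E) : F) - ((x : E) : F)‖ < η →
        ∃ y ∈ D, ‖(x : E) - (y : E)‖ < 3 * η := by
  set S : Set (UnitSphere E) := {x | ‖hV.proj J ((x : E) : F) - ((x : E) : F)‖ < η} with hS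
  set W : Submodule 𝕜 F := (Finset.Icc J.fst J.snd).sup V with hW
  have hVfin := hV.1
  have hWfin : FiniteDimensional 𝕜 W := Submodule.finiteDimensional_finset_sup _ _
  have hmem : ∀ x : F, hV.proj J x ∈ W := fun x =>
    Submodule.sum_mem _ fun i hi =>
      (Finset.le_sup hi : V i ≤ W) ((hV.2 x).exists.choose_spec.1 i)
  let P : UnitSphere E → W := fun x => ⟨hV.proj J ((x : E) : F), hmem _⟩
  have hproper : ProperSpace W := FiniteDimensional.proper 𝕜 W
  -- Continuity of the projection is not needed: points of `S` are unit vectors within `η` of their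
  -- images.
  have hsub : P '' S ⊆ Metric.closedBall 0 (1 + η) := by
    rintro _ ⟨x, hx, rfl⟩
    have hx1 : ‖((x : E) : F)‖ = 1 := norm_eq_of_mem_sphere x
    have hx2 : ‖hV.proj J ((x : E) : F) - ((x : E) : F)‖ < η := hx
    have h3 := norm_le_norm_add_norm_sub' (hV.proj J ((x : E) : F)) ((x : E) : F)
    rw [mem_closedBall_zero_iff]
    change ‖hV.proj J ((x : E) : F)‖ ≤ 1 + η
    linarith
  have htb : TotallyBounded (P '' S) := (isCompact_closedBall _ _).totallyBounded.subset hsub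
  obtain ⟨D, hDS, hDfin, hcov⟩ := Set.exists_subset_image_finite_and.1
    (totallyBounded_iff_subset.1 htb _ (Metric.dist_mem_uniformity hη))
  refine ⟨D, hDfin, fun y hy => hDS hy, fun x hx => ?_⟩
  have h := hcov ⟨x, hx, rfl⟩
  simp only [Set.mem_iUnion, exists_prop] at h
  obtain ⟨_, ⟨y, hy, rfl⟩, hxz⟩ := h
  refine ⟨y, hy, ?_⟩
  have h1 : ‖hV.proj J ((x : E) : F) - hV.proj J ((y : E) : F)‖ < η := by
    rw [← dist_eq_norm]; exact hxz
  have h2 : ‖hV.proj J ((y : E) : F) - ((y : E) : F)‖ < η := hDS hy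
  have h3 : ((x : E) : F) - ((y : E) : F) =
      -(hV.proj J ((x : E) : F) - ((x : E) : F)) +
        (hV.proj J ((x : E) : F) - hV.proj J ((y : E) : F)) +
        (hV.proj J ((y : E) : F) - ((y : E) : F)) := by abel
  change ‖((x : E) : F) - ((y : E) : F)‖ < 3 * η
  rw [h3]
  refine (norm_add₃_le).trans_lt ?_
  rw [norm_neg]
  linarith

/-- A move of player II in the unfolded game: a move in the original game, and perhaps a further
term of a parameter in the Baire space. -/
abbrev UnfoldedMove (E : Submodule 𝕜 F) : Type _ :=
  (UnitSphere E × NonemptyInterval ℕ) × Option ℕ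

/-- A position of the unfolded game: the moves of II and the known terms of the parameter. -/
abbrev UnfoldedPos (E : Submodule 𝕜 F) : Type _ :=
  List (UnitSphere E × NonemptyInterval ℕ) × List ℕ

/-- The position after a further move of II. -/
def UnfoldedPos.next (p : UnfoldedPos E) (a : UnfoldedMove E) : UnfoldedPos E :=
  (p.1 ++ [a.1], p.2 ++ a.2.toList)

/-- The position is compatible with some parameter `w`, up to `ε`. -/
def UnfoldedPos.Compatible (f : (ℕ → ℕ) → ℕ → UnitSphere E) (ε : ℕ → ℝ) (p : UnfoldedPos E) :
    Prop :=
  ∃ w : ℕ → ℕ, (∀ i (h : i < p.2.length), p.2[i] = w i) ∧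
    ∀ i (h : i < p.1.length), ‖(f w i : E) - (p.1[i].1 : E)‖ ≤ ε i

/-- The rules for player II in the unfolded game. -/
def UnfoldedPos.Legal (hV : IsFDD V) (δ ε : ℕ → ℝ) (f : (ℕ → ℕ) → ℕ → UnitSphere E)
    (p : UnfoldedPos E) (n : ℕ) (a : UnfoldedMove E) : Prop :=
  ‖((a.1.1 : E) : F) - hV.proj a.1.2 ((a.1.1 : E) : F)‖ < δ p.1.length ∧ n < a.1.2.fst ∧
    (∀ b ∈ p.1.getLast?, b.2.snd < a.1.2.fst) ∧ (p.next a).Compatible f ε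

/-- The position after the first `k` moves of a sequence of moves. -/
def UnfoldedPos.play (a : ℕ → UnfoldedMove E) (k : ℕ) : UnfoldedPos E :=
  ((List.range k).map fun i => (a i).1, (List.range k).flatMap fun i => (a i).2.toList)

theorem UnfoldedPos.play_succ (a : ℕ → UnfoldedMove E) (k : ℕ) :
    UnfoldedPos.play a (k + 1) = (UnfoldedPos.play a k).next (a k) := by
  simp [UnfoldedPos.play, UnfoldedPos.next, List.range_succ]

theorem UnfoldedPos.eq_play {p : ℕ → UnfoldedPos E} {a : ℕ → UnfoldedMove E} (h0 : p 0 = ([], []))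
    (hs : ∀ k, p (k + 1) = (p k).next (a k)) (k : ℕ) : p k = UnfoldedPos.play a k := by
  induction k with
  | zero => rw [h0]; rfl
  | succ k ih => rw [hs, ih, play_succ]

theorem UnfoldedPos.length_play_fst (a : ℕ → UnfoldedMove E) (k : ℕ) :
    (UnfoldedPos.play a k).1.length = k := by
  simp [UnfoldedPos.play]

theorem UnfoldedPos.play_snd_prefix (a : ℕ → UnfoldedMove E) {k l : ℕ} (h : k ≤ l) :
    (UnfoldedPos.play a k).2 <+: (UnfoldedPos.play a l).2 := by
  induction l, h using Nat.le_induction with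
  | base => exact List.prefix_refl _
  | succ l _ ih =>
    rw [play_succ]
    exact ih.trans (List.prefix_append _ _)

theorem UnfoldedPos.exists_lt_length (a : ℕ → UnfoldedMove E)
    (hinf : ∃ᶠ k in atTop, (a k).2.isSome) (i : ℕ) :
    ∃ k, i < (UnfoldedPos.play a k).2.length := by
  induction i with
  | zero =>
    obtain ⟨k, hk⟩ := hinf.exists
    refine ⟨k + 1, ?_⟩
    obtain ⟨d, hd⟩ := Option.isSome_iff_exists.1 hk
    rw [play_succ]
    simp [next, hd]
  | succ i ih =>
    obtain ⟨k, hk⟩ := ih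
    obtain ⟨l, hkl, hl⟩ := frequently_atTop.1 hinf k
    refine ⟨l + 1, ?_⟩
    obtain ⟨d, hd⟩ := Option.isSome_iff_exists.1 hl
    have := (play_snd_prefix a hkl).length_le
    rw [play_succ]
    simp only [next, hd, Option.toList_some, List.length_append, List.length_singleton]
    omega

/-- If all positions of a play are compatible with a parameter, and the play determines a
parameter completely, then the play is close to the value of `f` at that parameter. -/
theorem UnfoldedPos.mem_of_compatible {f : (ℕ → ℕ) → ℕ → UnitSphere E} (hf : Continuous f)
    {ε : ℕ → ℝ} {a : ℕ → UnfoldedMove E} (hc : ∀ k, (UnfoldedPos.play a k).Compatible f ε)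
    (hinf : ∃ᶠ k in atTop, (a k).2.isSome) :
    ∃ w, ∀ i, ‖(f w i : E) - ((a i).1.1 : E)‖ ≤ ε i := by
  choose K hK using exists_lt_length a hinf
  choose u hu hu' using hc
  let w : ℕ → ℕ := fun i => (play a (K i)).2[i]'(hK i)
  have hw : ∀ i k (h : i < (play a k).2.length), (play a k).2[i] = w i := by
    intro i k h
    rcases le_total k (K i) with hk | hk
    · exact (play_snd_prefix a hk).getElem h
    · exact ((play_snd_prefix a hk).getElem (hK i)).symm
  have hlim : Tendsto u atTop (𝓝 w) := by
    rw [tendsto_pi_nhds]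
    intro i
    refine tendsto_const_nhds.congr' ?_
    filter_upwards [eventually_ge_atTop (K i)] with k hk
    have h : i < (play a k).2.length := (hK i).trans_le (play_snd_prefix a hk).length_le
    rw [← hu k i h, hw i k h]
  refine ⟨w, fun i => ?_⟩
  have h1 : Tendsto (fun k => (f (u k) i : E)) atTop (𝓝 (f w i : E)) :=
    (continuous_subtype_val.tendsto _).comp
      (((continuous_apply i).tendsto _).comp ((hf.tendsto w).comp hlim))
  -- The bounds in `Compatible` are non-strict so that they survive this limit.
  refine le_of_tendsto (h1.sub_const _).norm ?_
  filter_upwards [eventually_gt_atTop i] with k hk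
  have h := hu' k i (by rwa [length_play_fst])
  simpa [play] using h

/-- A positional winning strategy of II in the unfolded game gives a strategy in the game. -/
theorem exists_strategy_of_unfolded {hV : IsFDD V} {δ ε : ℕ → ℝ} (hε : ∀ i, ε i < δ i)
    {f : (ℕ → ℕ) → ℕ → UnitSphere E} (hf : Continuous f)
    {ans : UnfoldedPos E → ℕ → UnfoldedMove E}
    (hans : ∀ (n : ℕ → ℕ) (p : ℕ → UnfoldedPos E), p 0 = ([], []) →
      (∀ k, p (k + 1) = (p k).next (ans (p k) (n k))) →
      (∀ k, (p k).Legal hV δ ε f (n k) (ans (p k) (n k))) ∧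
        ∃ᶠ k in atTop, (ans (p k) (n k)).2.isSome) :
    ∃ σ : StrategyII E, σ.PlaysInto hV δ (expansion (Set.range f) δ) := by
  let pos : List ℕ → UnfoldedPos E := List.foldl (fun p n => p.next (ans p n)) ([], [])
  refine ⟨fun l => (ans (pos l.dropLast) (l.getLast?.getD 0)).1, fun n => ?_⟩
  let p : ℕ → UnfoldedPos E := fun k => pos ((List.range k).map n)
  let a : ℕ → UnfoldedMove E := fun k => ans (p k) (n k)
  have hp : ∀ k, p (k + 1) = (p k).next (a k) := by
    intro k
    simp only [p, a, pos, map_range_succ, List.foldl_append, List.foldl_cons, List.foldl_nil]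
  have hanswer : ∀ k, StrategyII.answer
      (fun l => (ans (pos l.dropLast) (l.getLast?.getD 0)).1) n k = (a k).1 := by
    intro k
    simp [StrategyII.answer, map_range_succ, a, p]
  obtain ⟨hleg, hinf⟩ := hans n p rfl hp
  have hplay := UnfoldedPos.eq_play (p := p) rfl hp
  have hlen : ∀ k, (p k).1.length = k := fun k => by
    rw [hplay, UnfoldedPos.length_play_fst]
  simp only [hanswer]
  refine ⟨fun k => ?_, fun k => (hleg k).2.1, fun k => ?_, ?_⟩
  · have h := (hleg k).1
    rwa [hlen] at h
  · refine (hleg (k + 1)).2.2.1 (a k).1 ?_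
    rw [hp]
    simp [UnfoldedPos.next]
  · obtain ⟨w, hw⟩ := UnfoldedPos.mem_of_compatible (ε := ε) (a := a) hf (fun k => by
      cases k with
      | zero =>
        exact ⟨0, fun i h => absurd h (Nat.not_lt_zero _), fun i h => absurd h (Nat.not_lt_zero _)⟩
      | succ k =>
        rw [← hplay, hp]
        exact (hleg k).2.2.2) hinf
    exact ⟨f w, ⟨w, rfl⟩, fun i => (hw i).trans_lt (hε i)⟩

theorem finite_lists {α : Type*} {B : Set α} (hB : B.Finite) (N : ℕ) :
    {l : List α | l.length ≤ N ∧ ∀ x ∈ l, x ∈ B}.Finite := by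
  have := hB.to_subtype
  refine ((List.finite_length_le B N).image (List.map Subtype.val)).subset ?_
  rintro l ⟨hl, hlB⟩
  lift l to List B using hlB
  exact ⟨l, by simpa using hl, rfl⟩

/-- The positions built from points of `D`, with all numerical data bounded by `N`. -/
def boundedPositions (D : NonemptyInterval ℕ → ℕ → Set (UnitSphere E)) (N : ℕ) :
    Set (UnfoldedPos E) :=
  {l | l.length ≤ N ∧ ∀ b ∈ l, b ∈ {b | b.2.snd ≤ N ∧ ∃ i ≤ N, b.1 ∈ D b.2 i}} ×ˢ
    {s | s.length ≤ N ∧ ∀ d ∈ s, d ∈ Set.Iic N}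

theorem finite_boundedPositions {D : NonemptyInterval ℕ → ℕ → Set (UnitSphere E)}
    (hD : ∀ J k, (D J k).Finite) (N : ℕ) : (boundedPositions D N).Finite := by
  refine (finite_lists ?_ N).prod (finite_lists (Set.finite_Iic N) N)
  have hJ : {J : NonemptyInterval ℕ | J.snd ≤ N}.Finite := by
    refine Set.Finite.of_finite_image (f := NonemptyInterval.toProd)
      (((Set.finite_Iic N).prod (Set.finite_Iic N)).subset ?_)
      NonemptyInterval.toProd_injective.injOn
    rintro _ ⟨J, hJ, rfl⟩
    exact ⟨J.fst_le_snd.trans hJ, hJ⟩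
  refine ((hJ.biUnion fun J _ => (Set.finite_Iic N).biUnion fun i _ => hD J i).prod hJ).subset ?_
  rintro ⟨x, J⟩ ⟨h, i, hi, hx⟩
  refine ⟨?_, h⟩
  simp only [Set.mem_iUnion, exists_prop]
  exact ⟨J, h, i, hi, hx⟩

/-- Against a positional strategy `φ` of I in the unfolded game there is a sequence `m` that is
faster than the answers of `φ` in all the bounded positions. -/
theorem exists_dominating {Q : ℕ → Set (UnfoldedPos E)} (hQ : ∀ N, (Q N).Finite)
    (φ : UnfoldedPos E → ℕ) (p₀ : UnfoldedPos E) :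
    ∃ m : ℕ → ℕ, StrictMono m ∧ φ p₀ ≤ m 0 ∧ ∀ j, ∀ p ∈ Q (m j), φ p ≤ m (j + 1) := by
  choose g hg using fun N => ((hQ N).image φ).bddAbove
  refine ⟨fun j => (fun N => max (N + 1) (g N))^[j] (φ p₀), ?_, le_rfl, fun j p hp => ?_⟩
  · refine strictMono_nat_of_lt_succ fun j => ?_
    rw [Function.iterate_succ_apply']
    exact (Nat.lt_succ_self _).trans_le (le_max_left _ _)
  · simp only [Function.iterate_succ_apply']
    exact (hg _ ⟨p, hp, rfl⟩).trans (le_max_right _ _)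

/-- The number of terms of `w` revealed before round `k`, if in each round the next term is
revealed as soon as it is at most the number of the round. -/
def revealed (w : ℕ → ℕ) : ℕ → ℕ
  | 0 => 0
  | k + 1 => if w (revealed w k) ≤ k then revealed w k + 1 else revealed w k

theorem revealed_le (w : ℕ → ℕ) (k : ℕ) : revealed w k ≤ k := by
  induction k with
  | zero => exact le_rfl
  | succ k ih => rw [revealed]; split_ifs <;> omega

/-- If revealing stopped, the pending term would stay fixed while the round number grows past it. -/
theorem frequently_revealed (w : ℕ → ℕ) : ∃ᶠ k in atTop, w (revealed w k) ≤ k := by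
  rw [frequently_atTop]
  by_contra! h
  obtain ⟨K, hK⟩ := h
  have hconst : ∀ k ≥ K, revealed w k = revealed w K := by
    intro k hk
    induction k, hk using Nat.le_induction with
    | base => rfl
    | succ k hk ih => rw [revealed, if_neg (hK k hk).not_ge, ih]
  have h := hK (max K (w (revealed w K))) (le_max_left _ _)
  rw [hconst _ (le_max_left _ _)] at h
  exact absurd h (le_max_right _ _).not_gt

theorem flatMap_revealed (w : ℕ → ℕ) (k : ℕ) :
    ((List.range k).flatMap fun i =>
      (if w (revealed w i) ≤ i then some (w (revealed w i)) else none).toList) =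
      (List.range (revealed w k)).map w := by
  induction k with
  | zero => rfl
  | succ k ih =>
    rw [List.range_succ, List.flatMap_append, ih, revealed]
    split_ifs with h <;> simp [h, List.range_succ]

theorem strictMono_snd {I : ℕ → NonemptyInterval ℕ} (hI : ∀ i, (I i).snd < (I (i + 1)).fst) :
    StrictMono fun i => (I i).snd :=
  strictMono_nat_of_lt_succ fun i => (hI i).trans_le (I (i + 1)).fst_le_snd

/-- This is the purpose of the delay: revealed terms are bounded by the round number, whatever `w`
is. -/
theorem lt_of_lt_revealed (w : ℕ → ℕ) {i k : ℕ} (h : i < revealed w k) : w i < k := by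
  induction k with
  | zero => exact absurd h (Nat.not_lt_zero _)
  | succ k ih =>
    rw [revealed] at h
    split_ifs at h with hw
    · rcases Nat.lt_succ_iff_lt_or_eq.1 h with h | rfl
      · exact (ih h).trans (Nat.lt_succ_self _)
      · exact Nat.lt_succ_of_le hw
    · exact (ih h).trans (Nat.lt_succ_self _)

/-- If I had a positional winning strategy in the unfolded game, then some `m` would not be in
the relation `R_Δ` to any element of the expansion of `range f`, for a smaller `Δ`. -/
theorem not_unfolded_strategy {hV : IsFDD V} {δ : ℕ → ℝ} (hδ : DeltaPos δ)
    {f : (ℕ → ℕ) → ℕ → UnitSphere E}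
    (h : ∀ δ : ℕ → ℝ, DeltaPos δ → ∀ m : ℕ → ℕ, StrictMono m →
      ∃ x : ℕ → UnitSphere E, RelDelta hV δ m x ∧ x ∈ expansion (Set.range f) δ)
    {φ : UnfoldedPos E → ℕ}
    (hφ : ∀ (p : ℕ → UnfoldedPos E) (a : ℕ → UnfoldedMove E), p 0 = ([], []) →
      (∀ k, p (k + 1) = (p k).next (a k)) →
      (∀ k, (p k).Legal hV δ (fun i => δ i / 2) f (φ (p k)) (a k)) →
      ¬ ∃ᶠ k in atTop, (a k).2.isSome) : False := by
  -- An eighth for the expansion and three eighths for the net add up to the tolerance `δ i / 2`.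
  have hη : DeltaPos fun i => δ i / 8 := by
    refine ⟨fun i => div_pos (hδ.1 i) (by norm_num), fun i j hij => ?_, ?_⟩
    · exact div_le_div_of_nonneg_right (hδ.2.1 hij) (by norm_num)
    · simpa using hδ.2.2.div_const 8
  choose D hDfin hD hDnet using fun (J : NonemptyInterval ℕ) (k : ℕ) =>
    exists_finite_net (E := E) hV J (hη.1 k)
  obtain ⟨m, hm, hm0, hmQ⟩ := exists_dominating (finite_boundedPositions hDfin) φ ([], [])
  obtain ⟨x, ⟨I, ⟨hI, hxI⟩, hmI0, hmI⟩, _, ⟨w, rfl⟩, hw⟩ := h _ hη m hm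
  choose y hyD hxy using fun k => hDnet (I k) k (x k) (hxI k)
  let a : ℕ → UnfoldedMove E := fun k =>
    ((y k, I k), if w (revealed w k) ≤ k then some (w (revealed w k)) else none)
  have hsnd : ∀ k, (UnfoldedPos.play a k).2 = (List.range (revealed w k)).map w :=
    flatMap_revealed w
  have hcomp : ∀ k, (UnfoldedPos.play a k).Compatible f fun i => δ i / 2 := by
    intro k
    refine ⟨w, fun i hi => ?_, fun i hi => ?_⟩
    · simp [hsnd]
    · have h1 := hw i
      have h2 := hxy i
      have h3 := norm_sub_le_norm_sub_add_norm_sub (f w i : E) (x i : E) (y i : E)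
      simp only [UnfoldedPos.play, List.getElem_map, List.getElem_range, a]
      linarith
  have hk : ∀ k, k ≤ (I k).snd := (strictMono_snd hI).id_le
  refine hφ (UnfoldedPos.play a) a rfl (UnfoldedPos.play_succ a) (fun k => ⟨?_, ?_, ?_, ?_⟩) ?_
  · rw [UnfoldedPos.length_play_fst, norm_sub_rev]
    have h1 := hD _ _ _ (hyD k)
    have h2 := hδ.1 k
    refine h1.trans ?_
    simp only
    linarith
  · cases k with
    | zero => exact hm0.trans_lt hmI0
    | succ k =>
      obtain ⟨j, hj1, -, hj2⟩ := hmI k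
      -- Since `k ≤ (I k).snd < m j`, all data of the position after `k + 1` moves are at most `m
      -- j`, so the reply of `φ` is at most `m (j + 1)`.
      refine (hmQ j _ ⟨⟨?_, ?_⟩, ?_, ?_⟩).trans_lt hj2
      · rw [UnfoldedPos.length_play_fst]
        have := hk k
        omega
      · intro b hb
        simp only [UnfoldedPos.play, List.mem_map, List.mem_range] at hb
        obtain ⟨i, hi, rfl⟩ := hb
        have h1 : (I i).snd ≤ (I k).snd := (strictMono_snd hI).monotone (Nat.lt_succ_iff.1 hi)
        exact ⟨h1.trans hj1.le, i, (hk i).trans (h1.trans hj1.le), hyD i⟩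
      · rw [hsnd, List.length_map, List.length_range]
        have := hk k
        have := revealed_le w (k + 1)
        omega
      · intro d hd
        simp only [hsnd, List.mem_map, List.mem_range] at hd
        obtain ⟨i, hi, rfl⟩ := hd
        have := hk k
        have := lt_of_lt_revealed w hi
        change w i ≤ m j
        omega
  · intro b hb
    cases k with
    | zero => simp [UnfoldedPos.play] at hb
    | succ k =>
      rw [UnfoldedPos.play_succ] at hb
      simp only [UnfoldedPos.next, List.getLast?_append, List.getLast?_singleton,
        Option.some_or, Option.mem_def, Option.some.injEq] at hb
      subst hb
      exact hI k
  · rw [← UnfoldedPos.play_succ]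
    exact hcomp _
  · refine (frequently_revealed w).mono fun k hk => ?_
    simp [a, hk]

end Unfolding

end AsymptoticGame

/-! ### The equivalence -/

theorem mainTheorem6 {𝕜 F : Type*} [RCLike 𝕜] [NormedAddCommGroup F] [NormedSpace 𝕜 F]
    [CompleteSpace F] (V : ℕ → Submodule 𝕜 F) (hV : AsymptoticGame.IsFDD V)
    (E : Submodule 𝕜 F) (hE : IsClosed (E : Set F))
    (A : Set (ℕ → AsymptoticGame.UnitSphere E)) (hA : MeasureTheory.AnalyticSet A) :
    List.TFAE [
      ∀ δ : ℕ → ℝ, AsymptoticGame.DeltaPos δ → ∀ m : ℕ → ℕ, StrictMono m →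
        ∃ x : ℕ → AsymptoticGame.UnitSphere E,
          AsymptoticGame.RelDelta hV δ m x ∧ x ∈ AsymptoticGame.expansion A δ,
      ∀ δ : ℕ → ℝ, AsymptoticGame.DeltaPos δ →
        ∃ σ : AsymptoticGame.StrategyII E,
          σ.PlaysInto hV δ (AsymptoticGame.expansion A δ),
      ∀ δ : ℕ → ℝ, AsymptoticGame.DeltaPos δ →
        ∃ T : Set (List (AsymptoticGame.UnitSphere E)),
          AsymptoticGame.IsBlockTree hV δ T ∧
            AsymptoticGame.branches T ⊆ AsymptoticGame.expansion A δ] := by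
  open AsymptoticGame in
  tfae_have 1 → 2 := by
    intro h δ hδ
    -- One instance of (a) rules out the empty set and supplies a point of the sphere, hence a move.
    obtain ⟨x, -, x', hx', -⟩ := h δ hδ id strictMono_id
    rw [MeasureTheory.AnalyticSet] at hA
    obtain rfl | ⟨f, hf, rfl⟩ := hA
    · exact absurd hx' (Set.notMem_empty _)
    have : Nonempty (UnfoldedMove E) := ⟨((x 0, ⟨(0, 0), le_rfl⟩), none)⟩
    rcases buchi_determined (next := UnfoldedPos.next (E := E))
      (legal := UnfoldedPos.Legal hV δ (fun i => δ i / 2) f) (good := fun a => a.2.isSome) ([], []) with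
      ⟨ans, hans⟩ | ⟨φ, hφ⟩
    · exact exists_strategy_of_unfolded (fun i => half_lt_self (hδ.1 i)) hf hans
    · exact (not_unfolded_strategy hδ h hφ).elim
  tfae_have 2 → 3 := fun h δ hδ => (h δ hδ).choose_spec.exists_tree
  tfae_have 3 → 1 := by
    intro h δ hδ m hm
    obtain ⟨T, hT, hTA⟩ := h δ hδ
    obtain ⟨x, hx, hR⟩ := hT.exists_branch hm
    exact ⟨x, hR, hTA hx⟩
  tfae_finish
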